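/- A tournament $T=(V,A)$ consists of a finite vertex set $V$ and a set $A$ of ordered pairs of distinct vertices (arcs) such that for all $x\neq y$ in $V$ exactly one of $(x,y),(y,x)$ is an arc; $T[X]$ denotes the subtournament induced by $X\subseteq V$, and $T-x=T[V\setminus\{x\}]$. A set $I\subseteq V$ is an interval of $T$ if every $x\in V\setminus I$ either has arcs to all vertices of $I$ or receives arcs from all vertices of $I$. A tournament with at least $3$ vertices is indecomposable if its only intervals are $\varnothing$, $V$ and the singletons, and decomposable otherwise. A vertex $x$ of an indecomposable tournament $T$ is critical if $T-x$ is decomposable; an indecomposable tournament with at least $5$ vertices is critical if all its vertices are critical, and an indecomposable tournament is non-critical if it is not critical. A vertex $x$ of an indecomposable tournament $T$ is strongly critical if for every $X\subseteq V$ such that $x\in X$, $|X|\geq 5$ and $T[X]$ is indecomposable, $x$ is a critical vertex of $T[X]$. Let $\mathscr C(T)$ be the set of strongly critical vertices of $T$ and $f(T)=|\mathscr C(T)|$. For $n\geq 2$, let $W_{2n+1}$ be the tournament on $\{0,\dots,2n\}$ whose restriction to $\{0,\dots,2n-1\}$ is the usual total order (arcs $(i,j)$ for $i<j$), and in which the vertex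 $2n$ has arcs to all even elements of $\{0,\dots,2n-1\}$ and receives arcs from all odd elements. Let $W_{2n+2}$ be the tournament on $\{0,\dots,2n+1\}$ such that $W_{2n+2}-(2n+1)=W_{2n+1}$ and the out-neighbourhood of $2n+1$ is $\{2n-2,2n\}$. Then: 1. For every $n\geq 2$, $W_{2n+2}$ is indecomposable and non-critical, and $\mathscr C(W_{2n+2})=\{0,2n-2,2n-1,2n\}$; in particular $f(W_{2n+2})=4$. 2. For every $n\geq 3$, $W_{2n+2}-(2n-3)$ is indecomposable and non-critical, and $f(W_{2n+2}-(2n-3))=4$. 3. Consequently, for every $N$ there is an indecomposable non-critical tournament $T$ of even order at least $N$ with $f(T)=4$, and one of odd order at least $N$ with $f(T)=4$. -/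

import Mathlib

/-- A tournament on the vertex set `V`: between two distinct vertices there is exactly one arc,
and there are no loops. -/
structure Tournament (V : Type*) where
  /-- `Arc x y` says that `(x, y)` is an arc. -/
  Arc : V → V → Prop
  irrefl : ∀ x, ¬ Arc x x
  arc_iff : ∀ x y, x ≠ y → (Arc x y ↔ ¬ Arc y x)

namespace Tournament

variable {V : Type*}

/-- The subtournament `T[X]` induced by `X`. -/
def induce (T : Tournament V) (X : Set V) : Tournament X where
  Arc x y := T.Arc x y
  irrefl x := T.irrefl x
  arc_iff x y h := T.arc_iff x y (fun e => h (Subtype.ext e))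

/-- The subtournament `T - x`. -/
def delete (T : Tournament V) (x : V) : Tournament ({x}ᶜ : Set V) :=
  T.induce {x}ᶜ

/-- `I` is an interval of `T`: each vertex outside `I` dominates `I` or is dominated by `I`. -/
def IsInterval (T : Tournament V) (I : Set V) : Prop :=
  ∀ x, x ∉ I → (∀ y ∈ I, T.Arc x y) ∨ (∀ y ∈ I, T.Arc y x)

/-- A tournament with at least three vertices is indecomposable if all its intervals are
trivial. (`Nat.card V` is the order of a finite tournament, and `0` if `V` is infinite, so that
indecomposable tournaments are finite.) -/
def IsIndecomposable (T : Tournament V) : Prop :=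
  3 ≤ Nat.card V ∧ ∀ I : Set V, T.IsInterval I → I = ∅ ∨ (∃ x, I = {x}) ∨ I = Set.univ

/-- A tournament with at least three vertices is decomposable if it is not indecomposable. -/
def IsDecomposable (T : Tournament V) : Prop :=
  3 ≤ Nat.card V ∧ ¬ T.IsIndecomposable

/-- A critical vertex of an indecomposable tournament. -/
def IsCriticalVertex (T : Tournament V) (x : V) : Prop :=
  T.IsIndecomposable ∧ (T.delete x).IsDecomposable

/-- A critical tournament: indecomposable, with at least five vertices, all of them critical. -/
def IsCritical (T : Tournament V) : Prop :=
  T.IsIndecomposable ∧ 5 ≤ Nat.card V ∧ ∀ x, T.IsCriticalVertex x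

/-- A strongly critical vertex of an indecomposable tournament `T`: it is a critical vertex of
each indecomposable subtournament of order at least five that contains it. -/
def IsStronglyCriticalVertex (T : Tournament V) (x : V) : Prop :=
  T.IsIndecomposable ∧
    ∀ (X : Set V) (hx : x ∈ X), 5 ≤ X.ncard → (T.induce X).IsIndecomposable →
      (T.induce X).IsCriticalVertex ⟨x, hx⟩

/-- The set `𝒞(T)` of strongly critical vertices. -/
def stronglyCritical (T : Tournament V) : Set V := {x | T.IsStronglyCriticalVertex x}

/-- The number `f(T)` of strongly critical vertices. -/
noncomputable def f (T : Tournament V) : ℕ := T.stronglyCritical.ncard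

/-- The tournament `W_{2n+1}` on `{0, …, 2n}`: the usual total order on `{0, …, 2n-1}`, and the
odd vertices below `2n` dominate `2n`, which dominates the even vertices below `2n`. -/
def wOdd (n : ℕ) : Tournament (Fin (2 * n + 1)) where
  Arc i j :=
    (i.val < j.val ∧ j.val < 2 * n) ∨
    (i.val < 2 * n ∧ Odd i.val ∧ j.val = 2 * n) ∨
    (i.val = 2 * n ∧ j.val < 2 * n ∧ Even j.val)
  irrefl i := by omega
  arc_iff i j h := by
    have h' : i.val ≠ j.val := fun e => h (Fin.ext e)
    have hi := i.isLt
    have hj := j.isLt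
    simp only [Nat.odd_iff, Nat.even_iff]
    omega

/-- The tournament `W_{2n+2}` on `{0, …, 2n+1}`: `W_{2n+1}` together with the vertex `2n+1`,
whose out-neighbourhood is `{2n-2, 2n}`. -/
def wEven (n : ℕ) : Tournament (Fin (2 * n + 2)) where
  Arc i j :=
    (∃ (hi : i.val < 2 * n + 1) (hj : j.val < 2 * n + 1),
      (wOdd n).Arc ⟨i.val, hi⟩ ⟨j.val, hj⟩) ∨
    (i.val = 2 * n + 1 ∧ (j.val = 2 * n - 2 ∨ j.val = 2 * n)) ∨
    (i.val < 2 * n + 1 ∧ j.val = 2 * n + 1 ∧ ¬ (i.val = 2 * n - 2 ∨ i.val = 2 * n))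
  irrefl i := by
    rintro (⟨hi, hj, h⟩ | h | h)
    · exact (wOdd n).irrefl _ h
    · omega
    · omega
  arc_iff i j h := by
    have h' : i.val ≠ j.val := fun e => h (Fin.ext e)
    have hi := i.isLt
    have hj := j.isLt
    simp only [wOdd, Nat.odd_iff, Nat.even_iff, exists_prop]
    omega

end Tournament

/-! Below `2n` the vertices form a chain, and two consecutive members of the chain in a vertex set
`X` can be told apart only by `2n`, which sees parity, or by `2n+1`, which sees only whether a
vertex is `2n-2`. So in an indecomposable `T[X]` the chain must essentially alternate in parity,
since otherwise twins appear (`IndecOn.parity_ne`). It must also start with an even vertex, and once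
`|X| ≥ 4` the vertex `2n` must be present, since otherwise there is a source or `X` is too small.
Deleting `0`, `2n-2`, `2n-1` or `2n` always violates one of these constraints, so these four
vertices are strongly critical (`IndecOn.not_indecOn_diff`).

Conversely, `{0, 2n-2, 2n-1, 2n, 2n+1}` is indecomposable and stays so when vertices `k < 2n-2` of
alternating parity are appended after `0` (`indecOn_lastFourWith_insert`). This gives each remaining
vertex a small subtournament in which it is not critical (`exists_indecOn_diff`). Appending a whole
initial segment yields `W_{2n+2}` and `W_{2n+2} - (2n-3)`, and in both the last appended vertex is
not critical. -/

namespace Tournament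

open Set

/-- `I` is an interval of the subtournament `T[X]`, as a set of vertices of `T`. -/
def IsIntervalOn {V : Type*} (T : Tournament V) (X I : Set V) : Prop :=
  I ⊆ X ∧ ∀ x ∈ X, x ∉ I → (∀ y ∈ I, T.Arc x y) ∨ (∀ y ∈ I, T.Arc y x)

/-- All intervals of the subtournament `T[X]` are trivial. -/
def IndecOn {V : Type*} (T : Tournament V) (X : Set V) : Prop :=
  ∀ I, T.IsIntervalOn X I → I.Subsingleton ∨ I = X

/-! ### Intervals and indecomposability inside an ambient tournament -/

section General

variable {V W : Type*} {T : Tournament V} {S : Tournament W} {X I : Set V} {x y z : V}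

theorem Arc.asymm (h : T.Arc x y) : ¬ T.Arc y x := by
  have hne : x ≠ y := by
    rintro rfl
    exact T.irrefl _ h
  exact (T.arc_iff x y hne).1 h

theorem IsIntervalOn.mem (h : T.IsIntervalOn X I) (hx : x ∈ X) (hy : y ∈ I) (hz : z ∈ I)
    (hxy : T.Arc x y) (hzx : T.Arc z x) : x ∈ I := by
  by_contra hxI
  rcases h.2 x hx hxI with h | h
  · exact hzx.asymm (h z hz)
  · exact hxy.asymm (h y hy)

/-- Intervals are pulled back and pushed forward along `e`. Working with vertex sets of one ambient
tournament avoids nested subtypes when a vertex is deleted from an induced subtournament. -/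
theorem isIndecomposable_iff_indecOn_range {e : W → V} (inj : Function.Injective e)
    (he : ∀ x y, S.Arc x y ↔ T.Arc (e x) (e y)) :
    S.IsIndecomposable ↔ 3 ≤ (range e).ncard ∧ T.IndecOn (range e) := by
  have hcard : (range e).ncard = Nat.card W := by
    rw [← image_univ, ncard_image_of_injective _ inj, ncard_univ]
  rw [hcard]
  refine and_congr_right fun h3 => ⟨fun h I hI => ?_, fun h I hI => ?_⟩
  · have key : S.IsInterval (e ⁻¹' I) := by
      intro x hx
      refine (hI.2 (e x) ⟨x, rfl⟩ hx).imp ?_ ?_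
      · exact fun h y hy => (he _ _).2 (h _ hy)
      · exact fun h y hy => (he _ _).2 (h _ hy)
    have himg : e '' (e ⁻¹' I) = I := image_preimage_eq_of_subset hI.1
    rcases h _ key with h | ⟨x, h⟩ | h
    · left
      rw [← himg, h, image_empty]
      exact subsingleton_empty
    · left
      rw [← himg, h, image_singleton]
      exact subsingleton_singleton
    · right
      rw [← himg, h, image_univ]
  · have key : T.IsIntervalOn (range e) (e '' I) := by
      refine ⟨image_subset_range _ _, ?_⟩
      rintro _ ⟨x, rfl⟩ hx
      have hx' : x ∉ I := fun h => hx ⟨x, h, rfl⟩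
      refine (hI x hx').imp ?_ ?_
      · rintro h _ ⟨y, hy, rfl⟩
        exact (he _ _).1 (h y hy)
      · rintro h _ ⟨y, hy, rfl⟩
        exact (he _ _).1 (h y hy)
    rcases h _ key with h | h
    · have hs : I.Subsingleton := fun a ha b hb => inj (h ⟨a, ha, rfl⟩ ⟨b, hb, rfl⟩)
      rcases hs.eq_empty_or_singleton with h | h
      · exact Or.inl h
      · exact Or.inr (Or.inl h)
    · right; right
      rw [← image_univ] at h
      exact inj.image_injective h

theorem isIndecomposable_induce_iff {e : W → V} (inj : Function.Injective e)
    (he : ∀ x y, S.Arc x y ↔ T.Arc (e x) (e y)) (Y : Set W) :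
    (S.induce Y).IsIndecomposable ↔ 3 ≤ (e '' Y).ncard ∧ T.IndecOn (e '' Y) := by
  have := isIndecomposable_iff_indecOn_range (S := S.induce Y) (T := T)
    (e := fun y : Y => e y) (inj.comp Subtype.val_injective) (fun x y => he x y)
  rwa [show range (fun y : Y => e y) = e '' Y by ext; simp] at this

theorem isIndecomposable_delete_iff {e : W → V} (inj : Function.Injective e)
    (he : ∀ x y, S.Arc x y ↔ T.Arc (e x) (e y)) (w : W) :
    (S.delete w).IsIndecomposable ↔
      3 ≤ (range e \ {e w}).ncard ∧ T.IndecOn (range e \ {e w}) := by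
  have := isIndecomposable_induce_iff inj he ({w}ᶜ : Set W)
  rwa [image_compl_eq_range_sdiff_image inj, image_singleton] at this

/-- With `|X| ≥ 5`, at least four vertices remain after a deletion, so the bounds on the order in
`IsIndecomposable` and `IsDecomposable` hold automatically and only the intervals matter. -/
theorem isStronglyCriticalVertex_iff {e : W → V} (inj : Function.Injective e)
    (he : ∀ x y, S.Arc x y ↔ T.Arc (e x) (e y)) (w : W) :
    S.IsStronglyCriticalVertex w ↔ S.IsIndecomposable ∧
      ∀ X ⊆ range e, e w ∈ X → 5 ≤ X.ncard → T.IndecOn X → ¬ T.IndecOn (X \ {e w}) := by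
  have key : ∀ (Y : Set W) (hw : w ∈ Y), 5 ≤ Y.ncard →
      (((S.induce Y).delete ⟨w, hw⟩).IsDecomposable ↔ ¬ T.IndecOn (e '' Y \ {e w})) := by
    intro Y hw h5
    have hr : range (fun y : Y => e y) = e '' Y := by ext; simp
    have hiff := isIndecomposable_delete_iff (S := S.induce Y) (T := T)
      (e := fun y : Y => e y) (inj.comp Subtype.val_injective) (fun x y => he x y) ⟨w, hw⟩
    rw [hr] at hiff
    have hc : 3 ≤ (e '' Y \ {e w}).ncard := by
      have := ncard_sdiff_singleton_of_mem (mem_image_of_mem e hw)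
      rw [ncard_image_of_injective _ inj] at this
      omega
    have hc' : Nat.card (({⟨w, hw⟩}ᶜ : Set Y)) = (e '' Y \ {e w}).ncard := by
      rw [Nat.card_coe_set_eq, ← hr,
        ← ncard_image_of_injective _ (f := fun y : Y => e y) (inj.comp Subtype.val_injective),
        image_compl_eq_range_sdiff_image (f := fun y : Y => e y)
          (inj.comp Subtype.val_injective), image_singleton]
    unfold IsDecomposable
    rw [hc', hiff]
    tauto
  refine and_congr_right fun _ => ⟨fun h X hX hw h5 hi => ?_, fun h Y hw h5 hi => ?_⟩
  · have himg : e '' (e ⁻¹' X) = X := image_preimage_eq_of_subset hX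
    have h5' : 5 ≤ (e ⁻¹' X).ncard := by
      rwa [← ncard_image_of_injective _ inj, himg]
    have hi' : (S.induce (e ⁻¹' X)).IsIndecomposable := by
      rw [isIndecomposable_induce_iff inj he, himg]
      exact ⟨by omega, hi⟩
    have := (key _ hw h5').1 (h _ hw h5' hi').2
    rwa [himg] at this
  · refine ⟨hi, (key Y hw h5).2 ?_⟩
    rw [isIndecomposable_induce_iff inj he] at hi
    refine h _ (image_subset_range _ _) ⟨w, hw, rfl⟩ ?_ hi.2
    rwa [ncard_image_of_injective _ inj]

/-- Adding a vertex to an indecomposable subtournament: it is enough that the new vertex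
separates the old ones, and has no twin. -/
theorem IndecOn.insert (h : T.IndecOn X)
    (hsep : ∃ y ∈ X, ∃ z ∈ X, T.Arc x y ∧ T.Arc z x)
    (htwin : ∀ y ∈ X, ∃ z ∈ X, (T.Arc x z ∧ T.Arc z y) ∨ (T.Arc y z ∧ T.Arc z x)) :
    T.IndecOn (insert x X) := by
  intro I hI
  have hIX : T.IsIntervalOn X (I ∩ X) := by
    refine ⟨inter_subset_right, fun v hv hvI => ?_⟩
    refine (hI.2 v (mem_insert_of_mem _ hv) (fun h => hvI ⟨h, hv⟩)).imp ?_ ?_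
    · exact fun h y hy => h y hy.1
    · exact fun h y hy => h y hy.1
  -- If `I` has at most one vertex in `X`, the only possible bad case is a pair `{x, y}`, excluded
  -- by `htwin`. If `I` contains `X`, then `hsep` forces `x` into `I`.
  rcases h _ hIX with h | h
  · left
    by_cases hx : x ∈ I
    · by_contra hns
      have : ∃ y ∈ X, y ∈ I := by
        by_contra! hno
        refine hns fun a ha b hb => ?_
        rcases hI.1 ha with rfl | ha'
        · rcases hI.1 hb with rfl | hb'
          · rfl
          · exact absurd hb (hno b hb')
        · exact absurd ha (hno a ha')
      obtain ⟨y, hyX, hyI⟩ := this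
      obtain ⟨z, hzX, hz⟩ := htwin y hyX
      have hzI : z ∈ I := by
        rcases hz with ⟨h1, h2⟩ | ⟨h1, h2⟩
        · exact hI.mem (mem_insert_of_mem _ hzX) hyI hx h2 h1
        · exact hI.mem (mem_insert_of_mem _ hzX) hx hyI h2 h1
      have hzy : z = y := h ⟨hzI, hzX⟩ ⟨hyI, hyX⟩
      subst hzy
      rcases hz with ⟨_, h2⟩ | ⟨h2, _⟩
      · exact T.irrefl _ h2
      · exact T.irrefl _ h2
    · intro a ha b hb
      have aux : ∀ c ∈ I, c ∈ X := fun c hc => by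
        rcases hI.1 hc with rfl | h'
        · exact absurd hc hx
        · exact h'
      exact h ⟨ha, aux a ha⟩ ⟨hb, aux b hb⟩
  · right
    have hXI : X ⊆ I := inter_eq_right.1 h
    obtain ⟨y, hy, z, hz, h1, h2⟩ := hsep
    exact Subset.antisymm hI.1
      (insert_subset (hI.mem (mem_insert _ _) (hXI hy) (hXI hz) h1 h2) hXI)

/-- Indecomposability of a finite subtournament with vertices `v i` and out-neighbourhoods `N i`:
it is enough that the sets closed under adding separating vertices are trivial. -/
theorem indecOn_range_of_outNeighbors {m : ℕ} (v : Fin m → V) (N : Fin m → Finset (Fin m))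
    (hN : ∀ i, ∀ j ∈ N i, T.Arc (v i) (v j))
    (hclosed : ∀ s : Finset (Fin m),
      (∀ x, ∀ y ∈ s, ∀ z ∈ s, y ∈ N x → x ∈ N z → x ∈ s) → s.card ≤ 1 ∨ s = Finset.univ) :
    T.IndecOn (range v) := by
  classical
  intro I hI
  -- `N i` may omit out-neighbours: recording fewer arcs makes more sets closed, which only
  -- strengthens `hclosed`.
  have hs := hclosed (Finset.univ.filter fun i => v i ∈ I) fun x y hy z hz hxy hzx => by
    rw [Finset.mem_filter] at hy hz ⊢
    exact ⟨Finset.mem_univ _,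
      hI.mem ⟨x, rfl⟩ hy.2 hz.2 (hN _ _ hxy) (hN _ _ hzx)⟩
  rcases hs with h | h
  · left
    rw [Finset.card_le_one] at h
    intro a ha b hb
    obtain ⟨i, rfl⟩ := hI.1 ha
    obtain ⟨j, rfl⟩ := hI.1 hb
    rw [h i (by simpa using ha) j (by simpa using hb)]
  · right
    refine Subset.antisymm hI.1 ?_
    rintro _ ⟨i, rfl⟩
    have hi := Finset.mem_univ i
    rw [← h, Finset.mem_filter] at hi
    exact hi.2

theorem IndecOn.not_twins (h : T.IndecOn X) (h3 : 3 ≤ X.ncard) (hy : y ∈ X) (hz : z ∈ X)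
    (hyz : y ≠ z) (htwin : ∀ w ∈ X, w ≠ y → w ≠ z →
      (T.Arc w y ∧ T.Arc w z) ∨ (T.Arc y w ∧ T.Arc z w)) : False := by
  have hI : T.IsIntervalOn X {y, z} := by
    refine ⟨pair_subset hy hz, fun w hw hwI => ?_⟩
    simp only [mem_insert_iff, mem_singleton_iff, not_or] at hwI
    simpa using htwin w hw hwI.1 hwI.2
  rcases h _ hI with h | h
  · exact hyz (h (by simp) (by simp))
  · rw [← h, ncard_pair hyz] at h3
    omega

theorem IndecOn.not_source (h : T.IndecOn X) (h3 : 3 ≤ X.ncard) (hx : x ∈ X)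
    (hsrc : (∀ w ∈ X, w ≠ x → T.Arc x w) ∨ (∀ w ∈ X, w ≠ x → T.Arc w x)) : False := by
  have hI : T.IsIntervalOn X (X \ {x}) := by
    refine ⟨sdiff_subset, fun w hw hwI => ?_⟩
    have hwx : w = x := by simpa [hw] using hwI
    subst hwx
    exact hsrc.imp (fun h y hy => h y hy.1 hy.2) (fun h y hy => h y hy.1 hy.2)
  rcases h _ hI with h | h
  · have := ncard_sdiff_singleton_of_mem hx
    have hle : (X \ {x}).ncard ≤ 1 := by
      rcases h.eq_empty_or_singleton with h | ⟨y, h⟩ <;> simp [h]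
    omega
  · have : x ∈ X \ {x} := by rwa [h]
    exact this.2 rfl

end General

/-! ### Constraints on indecomposable subtournaments of `W_{2n+2}` -/

section WEven

variable {n : ℕ} {X : Set (Fin (2 * n + 2))}

theorem wEven_arc_iff (i j : Fin (2 * n + 2)) : (wEven n).Arc i j ↔
    (i.val < j.val ∧ j.val < 2 * n) ∨
    (i.val < 2 * n ∧ i.val % 2 = 1 ∧ j.val = 2 * n) ∨
    (i.val = 2 * n ∧ j.val < 2 * n ∧ j.val % 2 = 0) ∨
    (i.val = 2 * n + 1 ∧ (j.val = 2 * n - 2 ∨ j.val = 2 * n)) ∨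
    (i.val < 2 * n + 1 ∧ j.val = 2 * n + 1 ∧ ¬ (i.val = 2 * n - 2 ∨ i.val = 2 * n)) := by
  simp only [wEven, wOdd, Nat.odd_iff, Nat.even_iff, exists_prop]
  omega

variable {i j : Fin (2 * n + 2)}

theorem wEven_arc_of_lt (h : i.val < j.val) (hj : j.val < 2 * n) : (wEven n).Arc i j :=
  (wEven_arc_iff i j).2 (Or.inl ⟨h, hj⟩)

theorem wEven_arc_odd_top (hi : i.val < 2 * n) (h : i.val % 2 = 1) (hj : j.val = 2 * n) :
    (wEven n).Arc i j :=
  (wEven_arc_iff i j).2 (Or.inr (Or.inl ⟨hi, h, hj⟩))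

theorem wEven_arc_top_even (hi : i.val = 2 * n) (hj : j.val < 2 * n) (h : j.val % 2 = 0) :
    (wEven n).Arc i j :=
  (wEven_arc_iff i j).2 (Or.inr (Or.inr (Or.inl ⟨hi, hj, h⟩)))

theorem wEven_arc_from_last (hi : i.val = 2 * n + 1) (hj : j.val = 2 * n - 2 ∨ j.val = 2 * n) :
    (wEven n).Arc i j :=
  (wEven_arc_iff i j).2 (Or.inr (Or.inr (Or.inr (Or.inl ⟨hi, hj⟩))))

theorem wEven_arc_to_last (hi : i.val < 2 * n + 1) (hj : j.val = 2 * n + 1)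
    (h : i.val ≠ 2 * n - 2) (h' : i.val ≠ 2 * n) : (wEven n).Arc i j :=
  (wEven_arc_iff i j).2 (Or.inr (Or.inr (Or.inr (Or.inr ⟨hi, hj, by tauto⟩))))

theorem ncard_le_three_of_val {m p q r : ℕ} {Y : Set (Fin m)}
    (h : ∀ y ∈ Y, y.val = p ∨ y.val = q ∨ y.val = r) : Y.ncard ≤ 3 := by
  rw [← ncard_image_of_injective Y Fin.val_injective]
  have hsub : Fin.val '' Y ⊆ ({p, q, r} : Set ℕ) := by
    rintro _ ⟨y, hy, rfl⟩
    exact h y hy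
  refine (ncard_le_ncard hsub).trans ?_
  refine (ncard_insert_le _ _).trans ?_
  have := ncard_insert_le q ({r} : Set ℕ)
  rw [ncard_singleton] at this
  omega

theorem exists_least_val {m k : ℕ} {Y : Set (Fin m)} {v : Fin m} (hv : v ∈ Y) (hvk : v.val < k) :
    ∃ l ∈ Y, l.val < k ∧ ∀ y ∈ Y, l.val ≤ y.val := by
  obtain ⟨l, hl, hmin⟩ := exists_min_image Y Fin.val (toFinite _) ⟨v, hv⟩
  exact ⟨l, hl, (hmin v hv).trans_lt hvk, hmin⟩

theorem exists_greatest_val_lt {m k : ℕ} {Y : Set (Fin m)} {v : Fin m} (hv : v ∈ Y)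
    (hvk : v.val < k) : ∃ l ∈ Y, l.val < k ∧ ∀ y ∈ Y, y.val < k → y.val ≤ l.val := by
  obtain ⟨l, hl, hmax⟩ := exists_max_image {y ∈ Y | y.val < k} Fin.val (toFinite _) ⟨v, hv, hvk⟩
  exact ⟨l, hl.1, hl.2, fun y hy hyk => hmax y ⟨hy, hyk⟩⟩

/-- An indecomposable subtournament of `W_{2n+2}` with at least four vertices contains `2n`. -/
theorem IndecOn.top_mem (hn : 2 ≤ n) (h : (wEven n).IndecOn X) (h4 : 4 ≤ X.ncard) :
    ∃ a ∈ X, a.val = 2 * n := by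
  by_contra! ha
  by_cases hl : ∃ v ∈ X, v.val < 2 * n - 2
  · obtain ⟨v, hv, hvk⟩ := hl
    obtain ⟨l, hl, hlk, hmin⟩ := exists_least_val hv hvk
    refine h.not_source (by omega) hl (Or.inl fun w hw hwl => ?_)
    rw [wEven_arc_iff]
    have := ha w hw
    have := hmin w hw
    have := Fin.val_ne_of_ne hwl
    omega
  · push Not at hl
    have := ncard_le_three_of_val (Y := X) (p := 2 * n - 2) (q := 2 * n - 1) (r := 2 * n + 1)
      (fun y hy => by
        have := ha y hy
        have := hl y hy
        omega)
    omega

/-- The least vertex of an indecomposable subtournament of `W_{2n+2}` is even. -/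
theorem IndecOn.exists_even_least (hn : 2 ≤ n) (h : (wEven n).IndecOn X) (h4 : 4 ≤ X.ncard) :
    ∃ l ∈ X, l.val < 2 * n ∧ l.val % 2 = 0 ∧ ∀ y ∈ X, l.val ≤ y.val := by
  by_cases hl : ∃ v ∈ X, v.val < 2 * n
  · obtain ⟨v, hv, hvk⟩ := hl
    obtain ⟨l, hl, hlk, hmin⟩ := exists_least_val hv hvk
    refine ⟨l, hl, hlk, ?_, hmin⟩
    by_contra hodd
    refine h.not_source (by omega) hl (Or.inl fun w hw hwl => ?_)
    rw [wEven_arc_iff]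
    have := hmin w hw
    have := Fin.val_ne_of_ne hwl
    omega
  · push Not at hl
    have := ncard_le_three_of_val (Y := X) (p := 2 * n) (q := 2 * n) (r := 2 * n + 1)
      (fun y hy => by
        have := hl y hy
        omega)
    omega

/-- Consecutive vertices of an indecomposable subtournament have opposite parities, unless
`2n+1` tells them apart. -/
theorem IndecOn.parity_ne (h : (wEven n).IndecOn X) (h3 : 3 ≤ X.ncard)
    {y z : Fin (2 * n + 2)} (hy : y ∈ X) (hz : z ∈ X) (hyz : y.val < z.val) (hz2 : z.val < 2 * n)
    (hcons : ∀ w ∈ X, w.val ≤ y.val ∨ z.val ≤ w.val)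
    (hb : (∀ w ∈ X, w.val ≠ 2 * n + 1) ∨ (y.val ≠ 2 * n - 2 ∧ z.val ≠ 2 * n - 2)) :
    y.val % 2 ≠ z.val % 2 := by
  intro hpar
  refine h.not_twins h3 hy hz (fun e => by rw [e] at hyz; omega) fun w hw hwy hwz => ?_
  have hcases : w.val < y.val ∨ z.val < w.val := by
    have := hcons w hw
    have := Fin.val_ne_of_ne hwy
    have := Fin.val_ne_of_ne hwz
    omega
  rcases hcases with hw1 | hw1
  · exact Or.inl ⟨wEven_arc_of_lt hw1 (by omega), wEven_arc_of_lt (by omega) hz2⟩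
  by_cases hw2 : w.val < 2 * n
  · exact Or.inr ⟨wEven_arc_of_lt (by omega) hw2, wEven_arc_of_lt hw1 hw2⟩
  by_cases hw3 : w.val = 2 * n
  · rcases Nat.mod_two_eq_zero_or_one y.val with e | e
    · exact Or.inl ⟨wEven_arc_top_even hw3 (by omega) e, wEven_arc_top_even hw3 hz2 (by omega)⟩
    · exact Or.inr ⟨wEven_arc_odd_top (by omega) e hw3, wEven_arc_odd_top hz2 (by omega) hw3⟩
  · have hw4 : w.val = 2 * n + 1 := by omega
    have hyz' := hb.resolve_left (fun h => h w hw hw4)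
    exact Or.inr ⟨wEven_arc_to_last (by omega) hw4 hyz'.1 (by omega),
      wEven_arc_to_last (by omega) hw4 hyz'.2 (by omega)⟩

/-- In the presence of `2n+1`, the vertex `2n-2` without `2n-1` is a sink, while `2n-1` without
`2n-2` is a twin of `2n+1`. -/
theorem IndecOn.mem_of_last (hn : 2 ≤ n) (h : (wEven n).IndecOn X) (h3 : 3 ≤ X.ncard)
    {b : Fin (2 * n + 2)} (hb : b ∈ X) (hbv : b.val = 2 * n + 1)
    (hpq : ∃ v ∈ X, v.val = 2 * n - 2 ∨ v.val = 2 * n - 1) :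
    (∃ p ∈ X, p.val = 2 * n - 2) ∧ ∃ q ∈ X, q.val = 2 * n - 1 := by
  by_contra hno
  obtain ⟨v, hv, hvp | hvq⟩ := hpq
  · have hq : ∀ q ∈ X, q.val ≠ 2 * n - 1 := fun q hq e => hno ⟨⟨v, hv, hvp⟩, ⟨q, hq, e⟩⟩
    refine h.not_source h3 hv (Or.inr fun w hw hwv => ?_)
    rw [wEven_arc_iff]
    have := hq w hw
    have := Fin.val_ne_of_ne hwv
    omega
  · have hp : ∀ p ∈ X, p.val ≠ 2 * n - 2 := fun p hp e => hno ⟨⟨p, hp, e⟩, ⟨v, hv, hvq⟩⟩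
    refine h.not_twins h3 hv hb (fun e => by rw [e] at hvq; omega) fun w hw hwv hwb => ?_
    have hwp := hp w hw
    have hwv' := Fin.val_ne_of_ne hwv
    have hwb' := Fin.val_ne_of_ne hwb
    by_cases hw1 : w.val < 2 * n - 1
    · exact Or.inl ⟨wEven_arc_of_lt (by omega) (by omega),
        wEven_arc_to_last (by omega) hbv hwp (by omega)⟩
    · have hw2 : w.val = 2 * n := by omega
      exact Or.inr ⟨wEven_arc_odd_top (by omega) (by omega) hw2,
        wEven_arc_from_last hbv (Or.inr hw2)⟩

/-- Without `2n+1`, the greatest vertex below `2n` is odd. -/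
theorem IndecOn.greatest_odd (h : (wEven n).IndecOn X) (h3 : 3 ≤ X.ncard)
    (hb : ∀ w ∈ X, w.val ≠ 2 * n + 1) {l : Fin (2 * n + 2)} (hl : l ∈ X) (hl2 : l.val < 2 * n)
    (hmax : ∀ w ∈ X, w.val < 2 * n → w.val ≤ l.val) : l.val % 2 = 1 := by
  by_contra hev
  refine h.not_source h3 hl (Or.inr fun w hw hwl => ?_)
  rw [wEven_arc_iff]
  have := hmax w hw
  have := hb w hw
  have := Fin.val_ne_of_ne hwl
  omega

theorem mem_diff_singleton_of_val {m : ℕ} {Y : Set (Fin m)} {x y : Fin m} (hy : y ∈ Y)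
    (h : y.val ≠ x.val) : y ∈ Y \ {x} :=
  ⟨hy, fun e => h (congrArg Fin.val e)⟩

theorem IndecOn.not_indecOn_diff (hn : 2 ≤ n) (h : (wEven n).IndecOn X) (h5 : 5 ≤ X.ncard)
    {x : Fin (2 * n + 2)} (hx : x ∈ X)
    (hxv : x.val = 0 ∨ x.val = 2 * n - 2 ∨ x.val = 2 * n - 1 ∨ x.val = 2 * n) :
    ¬ (wEven n).IndecOn (X \ {x}) := by
  intro h'
  have hcard := ncard_sdiff_singleton_of_mem hx
  have h4 : 4 ≤ (X \ {x}).ncard := by omega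
  have hdiff : ∀ w ∈ X \ {x}, w ∈ X ∧ w.val ≠ x.val :=
    fun w hw => ⟨hw.1, fun e => hw.2 (Fin.ext e)⟩
  have hdiff' : ∀ w ∈ X, w.val ≠ x.val → w ∈ X \ {x} :=
    fun w hw e => mem_diff_singleton_of_val hw e
  obtain ⟨l, hl, hl2, hlpar, hlmin⟩ := h'.exists_even_least hn h4
  obtain ⟨hlX, hlx⟩ := hdiff l hl
  rcases hxv with hx0 | hxp | hxq | hxa
  -- The least vertex `l` left after deleting `0` is even, so `0` and `l` are twins in `X` unless
  -- `2n+1` separates them. In that case `l = 2n-2`, and `2n`, `2n+1` are twins in `X \ {0}`.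
  · by_cases hbl : (∀ w ∈ X, w.val ≠ 2 * n + 1) ∨ l.val ≠ 2 * n - 2
    · refine h.parity_ne (by omega) hx hlX (by omega) hl2 (fun w hw => ?_)
        (hbl.imp id fun h => ⟨by omega, h⟩) (by omega)
      by_cases hwx : w.val = x.val
      · omega
      · exact Or.inr (hlmin w (hdiff' w hw hwx))
    · push Not at hbl
      obtain ⟨⟨b, hb, hbv⟩, hlp⟩ := hbl
      obtain ⟨a, ha, hav⟩ := h'.top_mem hn h4
      refine h'.not_twins (by omega) ha (hdiff' b hb (by omega))
        (fun e => by rw [e] at hav; omega) fun w hw hwa hwb => ?_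
      have := hlmin w hw
      have := Fin.val_ne_of_ne hwa
      have := Fin.val_ne_of_ne hwb
      by_cases hwp : w.val = 2 * n - 2
      · exact Or.inr ⟨wEven_arc_top_even hav (by omega) (by omega),
          wEven_arc_from_last hbv (Or.inl hwp)⟩
      · exact Or.inl ⟨wEven_arc_odd_top (by omega) (by omega) hav,
          wEven_arc_to_last (by omega) hbv hwp (by omega)⟩
  · by_cases hb : ∃ b ∈ X, b.val = 2 * n + 1
    · obtain ⟨b, hb, hbv⟩ := hb
      obtain ⟨-, q, hq, hqv⟩ := h.mem_of_last hn (by omega) hb hbv ⟨x, hx, Or.inl hxp⟩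
      obtain ⟨⟨p, hp, hpv⟩, -⟩ := h'.mem_of_last hn (by omega) (hdiff' b hb (by omega)) hbv
        ⟨q, hdiff' q hq (by omega), Or.inr hqv⟩
      exact (hdiff p hp).2 (by omega)
    · push Not at hb
      -- Here `q = 2n-1`, being odd and at least `2n-2`. The predecessor `r` of `2n-2` is either
      -- even, a twin of `2n-2` in `X`, or odd, a twin of `2n-1` once `2n-2` is deleted.
      obtain ⟨q, hq, hq2, hqmax⟩ := exists_greatest_val_lt hx (k := 2 * n) (by omega)
      have hqodd := h.greatest_odd (by omega) hb hq hq2 hqmax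
      have := hqmax x hx (by omega)
      have hlt : l.val < 2 * n - 2 := by omega
      obtain ⟨r, hr, hr2, hrmax⟩ := exists_greatest_val_lt hlX hlt
      rcases Nat.mod_two_eq_zero_or_one r.val with hr0 | hr1
      · refine h.parity_ne (by omega) hr hx (by omega) (by omega) (fun w hw => ?_)
          (Or.inl hb) (by omega)
        have := hrmax w hw
        omega
      · refine h'.parity_ne (by omega) (hdiff' r hr (by omega)) (hdiff' q hq (by omega))
          (by omega) (by omega) (fun w hw => ?_)
          (Or.inl fun w hw => hb w hw.1) (by omega)
        have := hrmax w hw.1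
        have := (hdiff w hw).2
        omega
  · by_cases hb : ∃ b ∈ X, b.val = 2 * n + 1
    · obtain ⟨b, hb, hbv⟩ := hb
      obtain ⟨⟨p, hp, hpv⟩, -⟩ := h.mem_of_last hn (by omega) hb hbv ⟨x, hx, Or.inr hxq⟩
      obtain ⟨-, q, hq, hqv⟩ := h'.mem_of_last hn (by omega) (hdiff' b hb (by omega)) hbv
        ⟨p, hdiff' p hp (by omega), Or.inl hpv⟩
      exact (hdiff q hq).2 (by omega)
    · push Not at hb
      -- Without `2n+1`, the chain left after deleting `2n-1` ends in an odd `r`, which is then a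
      -- twin of `2n-1` in `X`.
      obtain ⟨r, hr, hr2, hrmax⟩ := exists_greatest_val_lt hl hl2
      have hrodd := h'.greatest_odd (by omega) (fun w hw => hb w hw.1) hr hr2 hrmax
      obtain ⟨hrX, hrx⟩ := hdiff r hr
      refine h.parity_ne (by omega) hrX hx (by omega) (by omega) (fun w hw => ?_)
        (Or.inl hb) (by omega)
      by_cases hwx : w.val = x.val
      · omega
      · have := hrmax w (hdiff' w hw hwx)
        omega
  · obtain ⟨a, ha, hav⟩ := h'.top_mem hn h4
    exact (hdiff a ha).2 (by omega)

/-! ### Building indecomposable subtournaments -/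

/-- The subtournament on `{2n-2, 2n-1, 2n, 2n+1}` and the vertices in `L`. -/
def lastFourWith (n : ℕ) (L : Set ℕ) : Set (Fin (2 * n + 2)) :=
  {i | i.val ∈ L ∨ 2 * n - 2 ≤ i.val}

theorem indecOn_lastFourWith_zero (hn : 2 ≤ n) : (wEven n).IndecOn (lastFourWith n {0}) := by
  have h := indecOn_range_of_outNeighbors (T := wEven n)
    ![⟨0, by omega⟩, ⟨2 * n - 2, by omega⟩, ⟨2 * n - 1, by omega⟩, ⟨2 * n, by omega⟩,
      ⟨2 * n + 1, by omega⟩]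
    ![{1, 2, 4}, {2}, {3, 4}, {0, 1}, {1, 3}] ?_ (by decide)
  · convert h using 1
    ext i
    simp only [lastFourWith, mem_ofPred_eq, Matrix.range_cons, Matrix.range_empty, mem_union,
      union_empty, mem_singleton_iff, Fin.ext_iff]
    omega
  · intro i j hj
    fin_cases i <;> fin_cases j <;> simp at hj <;> simp [wEven_arc_iff] <;> omega

theorem indecOn_order_five (hn : 2 ≤ n) {k : ℕ} (hk : k % 2 = 1) (hkn : k < 2 * n - 2) :
    (wEven n).IndecOn {i | i.val = 0 ∨ i.val = k ∨ (2 * n - 2 ≤ i.val ∧ i.val ≤ 2 * n)} := by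
  have h := indecOn_range_of_outNeighbors (T := wEven n)
    ![⟨0, by omega⟩, ⟨k, by omega⟩, ⟨2 * n - 2, by omega⟩, ⟨2 * n - 1, by omega⟩,
      ⟨2 * n, by omega⟩]
    ![{1, 2, 3}, {2, 3, 4}, {3}, {4}, {0, 2}] ?_ (by decide)
  · convert h using 1
    ext i
    simp only [mem_ofPred_eq, Matrix.range_cons, Matrix.range_empty, mem_union, union_empty,
      mem_singleton_iff, Fin.ext_iff]
    omega
  · intro i j hj
    fin_cases i <;> fin_cases j <;> simp at hj <;> simp [wEven_arc_iff] <;> omega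

/-- The new vertex `k` is separating because `0 → k → 2n+1`. Its only possible twin is its
predecessor `r`, and `2n` distinguishes the two by parity. -/
theorem indecOn_lastFourWith_insert (hn : 2 ≤ n) {L : Set ℕ} {k r : ℕ} (h0 : 0 ∈ L) (hr : r ∈ L)
    (hLr : ∀ l ∈ L, l ≤ r) (hrk : r < k) (hpar : r % 2 ≠ k % 2) (hk : k < 2 * n - 2)
    (h : (wEven n).IndecOn (lastFourWith n L)) :
    (wEven n).IndecOn (lastFourWith n (insert k L)) := by
  have hins : lastFourWith n (insert k L) =
      insert (⟨k, by omega⟩ : Fin (2 * n + 2)) (lastFourWith n L) := by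
    ext i
    simp only [lastFourWith, mem_ofPred_eq, mem_insert_iff, Fin.ext_iff, or_assoc]
  rw [hins]
  have hmem : ∀ v, ∀ hv : v < 2 * n + 2, 2 * n - 2 ≤ v →
      (⟨v, hv⟩ : Fin (2 * n + 2)) ∈ lastFourWith n L := fun v hv h => Or.inr h
  have h0mem : (⟨0, by omega⟩ : Fin (2 * n + 2)) ∈ lastFourWith n L := Or.inl h0
  have h0k : (wEven n).Arc ⟨0, by omega⟩ ⟨k, by omega⟩ :=
    wEven_arc_of_lt (Nat.zero_lt_of_lt hrk) (by simp only; omega)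
  have hkp : (wEven n).Arc ⟨k, by omega⟩ ⟨2 * n - 2, by omega⟩ :=
    wEven_arc_of_lt hk (by simp only; omega)
  have hkq : (wEven n).Arc ⟨k, by omega⟩ ⟨2 * n - 1, by omega⟩ :=
    wEven_arc_of_lt (by simp only; omega) (by simp only; omega)
  have hkb : (wEven n).Arc ⟨k, by omega⟩ ⟨2 * n + 1, by omega⟩ :=
    wEven_arc_to_last (by simp only; omega) rfl (by simp only; omega) (by simp only; omega)
  refine h.insert ⟨_, hmem (2 * n + 1) (by omega) (by omega), _, h0mem, hkb, h0k⟩ fun y hy => ?_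
  have hyL : y.val ≤ r ∨ 2 * n - 2 ≤ y.val := hy.imp (hLr _) id
  have hcases : y.val < r ∨ y.val = r ∨ y.val = 2 * n - 2 ∨ y.val = 2 * n - 1 ∨
    y.val = 2 * n ∨ y.val = 2 * n + 1 := by omega
  rcases hcases with e | e | e | e | e | e
  · exact ⟨⟨r, by omega⟩, Or.inl hr, Or.inr ⟨wEven_arc_of_lt e (by simp only; omega),
      wEven_arc_of_lt hrk (by simp only; omega)⟩⟩
  · refine ⟨_, hmem (2 * n) (by omega) (by omega), ?_⟩
    rcases Nat.mod_two_eq_zero_or_one k with hk2 | hk2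
    · exact Or.inr ⟨wEven_arc_odd_top (by omega) (by omega) rfl,
        wEven_arc_top_even rfl (by simp only; omega) hk2⟩
    · exact Or.inl ⟨wEven_arc_odd_top (by simp only; omega) hk2 rfl,
        wEven_arc_top_even rfl (by omega) (by omega)⟩
  · exact ⟨_, hmem (2 * n + 1) (by omega) (by omega),
      Or.inl ⟨hkb, wEven_arc_from_last rfl (Or.inl e)⟩⟩
  · exact ⟨_, hmem (2 * n - 2) (by omega) le_rfl,
      Or.inl ⟨hkp, wEven_arc_of_lt (by simp only; omega) (by omega)⟩⟩
  · exact ⟨_, h0mem, Or.inr ⟨wEven_arc_top_even e (by simp only; omega) rfl, h0k⟩⟩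
  · exact ⟨_, hmem (2 * n - 1) (by omega) (by omega), Or.inl ⟨hkq,
      wEven_arc_to_last (by simp only; omega) e (by simp only; omega) (by simp only; omega)⟩⟩

theorem indecOn_lastFourWith_Iic (hn : 2 ≤ n) (k : ℕ) (hk : k < 2 * n - 2) :
    (wEven n).IndecOn (lastFourWith n (Iic k)) := by
  induction k with
  | zero =>
    have : Iic 0 = ({0} : Set ℕ) := by ext; simp
    rw [this]
    exact indecOn_lastFourWith_zero hn
  | succ k ih =>
    have : Iic (k + 1) = insert (k + 1) (Iic k) := by
      ext j
      simp only [mem_Iic, mem_insert_iff]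
      omega
    rw [this]
    exact indecOn_lastFourWith_insert hn (r := k) (by simp) (by simp) (fun l hl => hl)
      (by omega) (by omega) hk (ih (by omega))

theorem five_le_ncard_of_val {m : ℕ} (g : Fin 5 → ℕ) (hg : Function.Injective g)
    {Y : Set (Fin m)} (hY : ∀ t, ∃ y ∈ Y, y.val = g t) : 5 ≤ Y.ncard := by
  rw [← ncard_image_of_injective Y Fin.val_injective]
  have hsub : range g ⊆ Fin.val '' Y := by
    rintro _ ⟨t, rfl⟩
    exact hY t
  refine le_trans ?_ (ncard_le_ncard hsub (toFinite _))
  rw [← image_univ, ncard_image_of_injective _ hg, ncard_univ, Nat.card_eq_fintype_card,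
    Fintype.card_fin]

theorem five_le_ncard_lastFourWith (hn : 2 ≤ n) {L : Set ℕ} (h0 : 0 ∈ L) :
    5 ≤ (lastFourWith n L).ncard := by
  refine five_le_ncard_of_val ![0, 2 * n - 2, 2 * n - 1, 2 * n, 2 * n + 1] ?_ ?_
  · intro s t
    fin_cases s <;> fin_cases t <;> simp <;> omega
  · intro t
    fin_cases t
    · exact ⟨⟨0, by omega⟩, Or.inl h0, rfl⟩
    · exact ⟨⟨2 * n - 2, by omega⟩, Or.inr (by simp only; omega), rfl⟩
    · exact ⟨⟨2 * n - 1, by omega⟩, Or.inr (by simp only; omega), rfl⟩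
    · exact ⟨⟨2 * n, by omega⟩, Or.inr (by simp only; omega), rfl⟩
    · exact ⟨⟨2 * n + 1, by omega⟩, Or.inr (by simp only; omega), rfl⟩

/-- Every other vertex is non-critical in a small subtournament. -/
theorem exists_indecOn_diff (hn : 2 ≤ n) {R : Set (Fin (2 * n + 2))}
    (hR : lastFourWith n {0, 1} ⊆ R) {x : Fin (2 * n + 2)} (hx : x ∈ R)
    (hxv : ¬ (x.val = 0 ∨ x.val = 2 * n - 2 ∨ x.val = 2 * n - 1 ∨ x.val = 2 * n)) :
    ∃ Y ⊆ R, x ∈ Y ∧ 5 ≤ Y.ncard ∧ (wEven n).IndecOn Y ∧ (wEven n).IndecOn (Y \ {x}) := by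
  have hU : ∀ k, k % 2 = 1 → k < 2 * n - 2 → (wEven n).IndecOn (lastFourWith n {k, 0}) :=
    fun k hk hkn => indecOn_lastFourWith_insert hn (r := 0) (by simp) (by simp) (by simp)
      (by omega) (by omega) hkn (indecOn_lastFourWith_zero hn)
  have hxlt := x.isLt
  have hsub : ∀ i : Fin (2 * n + 2), i.val = 0 ∨ i.val = 1 ∨ 2 * n - 2 ≤ i.val → i ∈ R :=
    fun i hi => hR (by simpa [lastFourWith, or_assoc] using hi)
  have hRx : ∀ i : Fin (2 * n + 2), i.val = x.val → i ∈ R := fun i hi => Fin.ext hi ▸ hx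
  -- Removing `2n+1` from `{0, 1}` and the last four leaves a copy of `W_5`. An odd `x` can follow
  -- `0` directly, whereas an even `x` needs `1` in between.
  by_cases hb : x.val = 2 * n + 1
  · refine ⟨lastFourWith n {1, 0}, fun i hi => ?_, Or.inr (by omega),
      five_le_ncard_lastFourWith hn (by simp), hU 1 (by omega) (by omega), ?_⟩
    · simp only [lastFourWith, mem_ofPred_eq, mem_insert_iff, mem_singleton_iff] at hi
      exact hsub i (by omega)
    · convert indecOn_order_five hn (k := 1) (by omega) (by omega) using 1
      ext i
      simp only [lastFourWith, mem_ofPred_eq, mem_insert_iff, mem_singleton_iff, mem_sdiff,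
        Fin.ext_iff]
      omega
  rcases Nat.mod_two_eq_zero_or_one x.val with hpar | hpar
  · refine ⟨lastFourWith n {x.val, 1, 0}, fun i hi => ?_, Or.inl (by simp),
      five_le_ncard_lastFourWith hn (by simp), ?_, ?_⟩
    · simp only [lastFourWith, mem_ofPred_eq, mem_insert_iff, mem_singleton_iff] at hi
      by_cases e : i.val = x.val
      · exact hRx i e
      · exact hsub i (by omega)
    · exact indecOn_lastFourWith_insert hn (r := 1) (by simp) (by simp) (by simp) (by omega)
        (by omega) (by omega) (hU 1 (by omega) (by omega))
    · convert hU 1 (by omega) (by omega) using 1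
      ext i
      simp only [lastFourWith, mem_ofPred_eq, mem_insert_iff, mem_singleton_iff, mem_sdiff,
        Fin.ext_iff]
      omega
  · refine ⟨lastFourWith n {x.val, 0}, fun i hi => ?_, Or.inl (by simp),
      five_le_ncard_lastFourWith hn (by simp), hU _ hpar (by omega), ?_⟩
    · simp only [lastFourWith, mem_ofPred_eq, mem_insert_iff, mem_singleton_iff] at hi
      by_cases e : i.val = x.val
      · exact hRx i e
      · exact hsub i (by omega)
    · convert indecOn_lastFourWith_zero hn using 1
      ext i
      simp only [lastFourWith, mem_ofPred_eq, mem_singleton_iff, mem_insert_iff, mem_sdiff,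
        Fin.ext_iff]
      omega

/-! ### Strongly critical vertices and non-criticality of the two families -/

/-- Criticality of the four vertices passes to every indecomposable copy of a subtournament. The
witnesses for the other vertices only need `0`, `1`, the last four and the vertex itself, hence
`hR`. -/
theorem image_stronglyCritical_of_range {W : Type*} {S : Tournament W} (hn : 2 ≤ n)
    {e : W → Fin (2 * n + 2)} (inj : Function.Injective e)
    (he : ∀ x y, S.Arc x y ↔ (wEven n).Arc (e x) (e y))
    (hR : lastFourWith n {0, 1} ⊆ range e) (hS : S.IsIndecomposable) :
    (fun w => (e w).val) '' S.stronglyCritical = {0, 2 * n - 2, 2 * n - 1, 2 * n} := by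
  ext v
  simp only [mem_image, mem_insert_iff, mem_singleton_iff, stronglyCritical, mem_ofPred_eq]
  constructor
  · rintro ⟨w, hw, rfl⟩
    rw [isStronglyCriticalVertex_iff inj he] at hw
    by_contra hv
    obtain ⟨Y, hYR, hwY, h5, hY, hY'⟩ := exists_indecOn_diff hn hR ⟨w, rfl⟩ hv
    exact hw.2 Y hYR hwY h5 hY hY'
  · intro hv
    obtain ⟨w, hw⟩ : (⟨v, by omega⟩ : Fin (2 * n + 2)) ∈ range e := by
      refine hR ?_
      simp only [lastFourWith, mem_ofPred_eq, mem_insert_iff, mem_singleton_iff]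
      omega
    have hwv : (e w).val = v := by rw [hw]
    refine ⟨w, ?_, hwv⟩
    rw [isStronglyCriticalVertex_iff inj he]
    refine ⟨hS, fun X _ hX h5 hi => hi.not_indecOn_diff hn h5 hX ?_⟩
    rw [hwv]
    exact hv

theorem f_eq_four_of_range {W : Type*} {S : Tournament W} (hn : 2 ≤ n)
    {e : W → Fin (2 * n + 2)} (inj : Function.Injective e)
    (he : ∀ x y, S.Arc x y ↔ (wEven n).Arc (e x) (e y))
    (hR : lastFourWith n {0, 1} ⊆ range e) (hS : S.IsIndecomposable) : S.f = 4 := by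
  have inj' : Function.Injective fun w => (e w).val := Fin.val_injective.comp inj
  rw [f, ← ncard_image_of_injective _ inj', image_stronglyCritical_of_range hn inj he hR hS]
  rw [ncard_insert_of_notMem, ncard_insert_of_notMem, ncard_pair]
  all_goals
    try simp only [mem_insert_iff, mem_singleton_iff]
    omega

theorem lastFourWith_Iic_eq_univ (n : ℕ) : lastFourWith n (Iic (2 * n - 3)) = univ := by
  ext i
  simp only [lastFourWith, mem_ofPred_eq, mem_Iic, mem_univ, iff_true]
  omega

theorem lastFourWith_Iic_diff (k : ℕ) (hk : k + 1 < 2 * n - 2) (v : Fin (2 * n + 2))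
    (hv : v.val = k + 1) :
    lastFourWith n (Iic (k + 1)) \ {v} = lastFourWith n (Iic k) := by
  ext i
  simp only [lastFourWith, mem_ofPred_eq, mem_Iic, mem_sdiff, mem_singleton_iff, Fin.ext_iff]
  omega

/-- A copy of `W_{2n+2}[{0, …, k+1} ∪ {2n-2, …, 2n+1}]` is indecomposable and non-critical. -/
theorem isIndecomposable_and_not_isCritical_of_range {W : Type*} {S : Tournament W} (hn : 2 ≤ n)
    {e : W → Fin (2 * n + 2)} (inj : Function.Injective e)
    (he : ∀ x y, S.Arc x y ↔ (wEven n).Arc (e x) (e y)) {k : ℕ} (hk : k + 1 < 2 * n - 2)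
    (hR : range e = lastFourWith n (Iic (k + 1))) :
    S.IsIndecomposable ∧ ¬ S.IsCritical := by
  constructor
  · rw [isIndecomposable_iff_indecOn_range inj he, hR]
    exact ⟨le_trans (by norm_num) (five_le_ncard_lastFourWith hn (by simp)),
      indecOn_lastFourWith_Iic hn _ hk⟩
  · rintro ⟨-, -, h⟩
    obtain ⟨w, hw⟩ : (⟨k + 1, by omega⟩ : Fin (2 * n + 2)) ∈ range e := by
      rw [hR]
      exact Or.inl (by simp)
    refine (h w).2.2 ?_
    rw [isIndecomposable_delete_iff inj he, hR, lastFourWith_Iic_diff k hk _ (by rw [hw])]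
    exact ⟨le_trans (by norm_num) (five_le_ncard_lastFourWith hn (by simp)),
      indecOn_lastFourWith_Iic hn _ (by omega)⟩

theorem wEven_indecomposable_not_critical (hn : 2 ≤ n) :
    (wEven n).IsIndecomposable ∧ ¬ (wEven n).IsCritical := by
  refine isIndecomposable_and_not_isCritical_of_range hn (e := id) Function.injective_id
    (fun _ _ => Iff.rfl) (k := 2 * n - 4) (by omega) ?_
  rw [range_id, show 2 * n - 4 + 1 = 2 * n - 3 by omega, lastFourWith_Iic_eq_univ]

/-- This is where `n ≥ 3` matters: for `n = 2` the deleted vertex `2n-3` would be `1`. -/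
theorem lastFourWith_subset_range_val (hn : 3 ≤ n) :
    lastFourWith n {0, 1} ⊆
      range (Subtype.val : ({⟨2 * n - 3, by omega⟩}ᶜ : Set (Fin (2 * n + 2))) → _) := by
  rw [Subtype.range_val]
  intro i
  simp only [lastFourWith, mem_ofPred_eq, mem_insert_iff, mem_singleton_iff, mem_compl_iff,
    Fin.ext_iff]
  omega

theorem wEven_delete_indecomposable_not_critical (hn : 3 ≤ n) :
    ((wEven n).delete ⟨2 * n - 3, by omega⟩).IsIndecomposable ∧
      ¬ ((wEven n).delete ⟨2 * n - 3, by omega⟩).IsCritical := by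
  -- With `2n-3` deleted, the initial segment ends at `k + 1 = 2n-4`, which is the non-critical
  -- vertex.
  refine isIndecomposable_and_not_isCritical_of_range (n := n) (by omega) (e := Subtype.val)
    Subtype.val_injective (fun _ _ => Iff.rfl) (k := 2 * n - 5) (by omega) ?_
  rw [Subtype.range_val]
  ext i
  simp only [lastFourWith, mem_ofPred_eq, mem_Iic, mem_compl_iff, mem_singleton_iff, Fin.ext_iff]
  omega

theorem wEven_f (hn : 2 ≤ n) : (wEven n).f = 4 :=
  f_eq_four_of_range hn Function.injective_id (fun _ _ => Iff.rfl) (by simp)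
    (wEven_indecomposable_not_critical hn).1

theorem wEven_delete_f (hn : 3 ≤ n) : ((wEven n).delete ⟨2 * n - 3, by omega⟩).f = 4 :=
  f_eq_four_of_range (n := n) (by omega) Subtype.val_injective (fun _ _ => Iff.rfl)
    (lastFourWith_subset_range_val hn) (wEven_delete_indecomposable_not_critical hn).1

end WEven

end Tournament

theorem mainTheorem3 :
    (∀ n : ℕ, 2 ≤ n →
      (Tournament.wEven n).IsIndecomposable ∧
      ¬ (Tournament.wEven n).IsCritical ∧
      (Fin.val '' (Tournament.wEven n).stronglyCritical : Set ℕ) =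
        {0, 2 * n - 2, 2 * n - 1, 2 * n} ∧
      (Tournament.wEven n).f = 4) ∧
    (∀ n : ℕ, 3 ≤ n →
      ((Tournament.wEven n).delete ⟨2 * n - 3, by omega⟩).IsIndecomposable ∧
      ¬ ((Tournament.wEven n).delete ⟨2 * n - 3, by omega⟩).IsCritical ∧
      ((Tournament.wEven n).delete ⟨2 * n - 3, by omega⟩).f = 4) ∧
    (∀ N : ℕ, ∃ (V : Type) (_ : Finite V) (T : Tournament V),
      N ≤ Nat.card V ∧ Even (Nat.card V) ∧ T.IsIndecomposable ∧ ¬ T.IsCritical ∧ T.f = 4) ∧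
    (∀ N : ℕ, ∃ (V : Type) (_ : Finite V) (T : Tournament V),
      N ≤ Nat.card V ∧ Odd (Nat.card V) ∧ T.IsIndecomposable ∧ ¬ T.IsCritical ∧ T.f = 4) := by
  refine ⟨fun n hn => ?_, fun n hn => ?_, fun N => ?_, fun N => ?_⟩
  · have h := Tournament.wEven_indecomposable_not_critical hn
    exact ⟨h.1, h.2, Tournament.image_stronglyCritical_of_range hn Function.injective_id
      (fun _ _ => Iff.rfl) (by simp) h.1, Tournament.wEven_f hn⟩
  · have h := Tournament.wEven_delete_indecomposable_not_critical hn
    exact ⟨h.1, h.2, Tournament.wEven_delete_f hn⟩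
  · have hn : 2 ≤ N + 2 := by omega
    have h := Tournament.wEven_indecomposable_not_critical hn
    refine ⟨_, inferInstance, Tournament.wEven (N + 2), ?_, ?_, h.1, h.2, Tournament.wEven_f hn⟩
    · rw [Nat.card_eq_fintype_card, Fintype.card_fin]
      omega
    · rw [Nat.card_eq_fintype_card, Fintype.card_fin, Nat.even_iff]
      omega
  · have hn : 3 ≤ N + 3 := by omega
    have h := Tournament.wEven_delete_indecomposable_not_critical hn
    have hcard : Nat.card
        ({⟨2 * (N + 3) - 3, by omega⟩}ᶜ : Set (Fin (2 * (N + 3) + 2))) = 2 * N + 7 := by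
      rw [Nat.card_coe_set_eq, Set.ncard_compl, Set.ncard_singleton, Nat.card_eq_fintype_card,
        Fintype.card_fin]
      omega
    refine ⟨_, inferInstance, (Tournament.wEven (N + 3)).delete ⟨2 * (N + 3) - 3, by omega⟩,
      ?_, ?_, h.1, h.2, Tournament.wEven_delete_f hn⟩
    · rw [hcard]
      omega
    · rw [hcard, Nat.odd_iff]
      omega
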